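/- Let $N$ be a natural number. For $P\in\mathbb{C}^{N\times N}$ put $\mathcal{E}(P)=\{(n,l): P_{nl}\neq 0\}$ and let $$\operatorname{spr}(P)=\{M\in\mathbb{C}^{N\times N} : P_{nl}=0 \text{ implies } M_{nl}=0\},$$ a linear subspace of $\mathbb{C}^{N\times N}$, with its subspace topology and with Lebesgue measure $\operatorname{meas}_{\operatorname{spr}(P)}$ (Lebesgue measure in the free entries, $\operatorname{spr}(P)\cong\mathbb{C}^{\mathcal{E}(P)}$). Let $\bar A,\bar B\in\{0,1\}^{N\times N}$ have strictly non-zero diagonals. Suppose that the pair $(\bar A,\bar B)$ is compatible, i.e. $\mathcal{E}(\bar B)\subseteq\mathcal{E}(\bar A)$, and that $\bar A\bar B$ is a simple extension of $(\bar A,\bar B)$, i.e. for every $(m,l)\in\mathcal{E}(\bar B)$ the set $$\beta_{(m,l)}(\bar B)=\{(n,l)\in\mathcal{E}(\bar A\bar B)\setminus\mathcal{E}(\bar A) : \bar A_{nm}\bar B_{ml}\neq 0\}$$ has at most one element. Let $F:\operatorname{spr}(\bar A)\times\operatorname{spr}(\bar B)\to\operatorname{spr}(\bar A\bar B)$, $F(X,Y)=XY$,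 and let $R=F(\operatorname{spr}(\bar A)\times\operatorname{spr}(\bar B))$ be its range. Then $R$ contains an open dense subset of $\operatorname{spr}(\bar A\bar B)$, and $$\operatorname{meas}_{\operatorname{spr}(\bar A\bar B)}\bigl(\operatorname{cl}(\operatorname{spr}(\bar A\bar B)\setminus R)\bigr)=0.$$ That is, the equation $XY=C$ has a solution $X\in\operatorname{spr}(\bar A)$, $Y\in\operatorname{spr}(\bar B)$ for almost all $C\in\operatorname{spr}(\bar A\bar B)$: the set of $C$ for which it has none is Lebesgue-null, and its closure is nowhere dense in $\operatorname{spr}(\bar A\bar B)$. -/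

import Mathlib

open MeasureTheory

namespace SparseProd

/-- The edge set `E(P) = {(n, l) : P n l ≠ 0}` of a complex `N × N` matrix. -/
noncomputable def edges {N : ℕ} (P : Matrix (Fin N) (Fin N) ℂ) : Finset (Fin N × Fin N) :=
  Finset.univ.filter fun p => P p.1 p.2 ≠ 0

/-- The sparsity class `spr(P)`: the complex subspace of the matrices that vanish wherever `P`
vanishes. It carries the subspace topology. -/
def spr {N : ℕ} (P : Matrix (Fin N) (Fin N) ℂ) : Submodule ℂ (Matrix (Fin N) (Fin N) ℂ) where
  carrier := {M | ∀ n l, P n l = 0 → M n l = 0}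
  zero_mem' := fun _ _ _ => rfl
  add_mem' := fun {X Y} hX hY n l h => by
    rw [Matrix.add_apply, hX n l h, hY n l h, add_zero]
  smul_mem' := fun c X hX n l h => by
    rw [Matrix.smul_apply, hX n l h, smul_zero]

/-- `P` is a matrix with entries in `{0, 1}`. -/
def IsZeroOne {N : ℕ} (P : Matrix (Fin N) (Fin N) ℂ) : Prop :=
  ∀ n l, P n l = 0 ∨ P n l = 1

/-- A compatible tuple `(A, B)`: `0`-`1` matrices with non-zero diagonals and `E(B) ⊆ E(A)`. -/
structure IsCompatible {N : ℕ} (A B : Matrix (Fin N) (Fin N) ℂ) : Prop where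
  zeroOne_left : IsZeroOne A
  zeroOne_right : IsZeroOne B
  diag_left : ∀ n, A n n ≠ 0
  diag_right : ∀ n, B n n ≠ 0
  edges_subset : edges B ⊆ edges A

/-- The set `β_{(m, l)}(B)` of the new edges `(n, l) ∈ E(AB) \ E(A)` with `A n m * B m l ≠ 0`. -/
noncomputable def newEdges {N : ℕ} (A B : Matrix (Fin N) (Fin N) ℂ) (m l : Fin N) :
    Finset (Fin N × Fin N) :=
  (edges (A * B) \ edges A).filter fun p => p.2 = l ∧ A p.1 m * B m l ≠ 0

/-- The product `AB` is a simple extension of `(A, B)`: every edge of `B` generates at most one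
new edge. -/
def IsSimpleExtension {N : ℕ} (A B : Matrix (Fin N) (Fin N) ℂ) : Prop :=
  ∀ m l, (m, l) ∈ edges B → (newEdges A B m l).card ≤ 1

theorem mul_mem_spr {N : ℕ} {A B : Matrix (Fin N) (Fin N) ℂ} (hA : IsZeroOne A)
    (hB : IsZeroOne B) {X Y : Matrix (Fin N) (Fin N) ℂ} (hX : X ∈ spr A) (hY : Y ∈ spr B) :
    X * Y ∈ spr (A * B) := by
  intro n l h
  rw [Matrix.mul_apply] at h ⊢
  have hre : ∑ m, (A n m * B m l).re = 0 := by
    rw [← Complex.re_sum, h, Complex.zero_re]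
  have hnn : ∀ m ∈ Finset.univ, 0 ≤ (A n m * B m l).re := by
    intro m _
    rcases hA n m with h1 | h1 <;> rcases hB m l with h2 | h2 <;> simp [h1, h2]
  have hz := (Finset.sum_eq_zero_iff_of_nonneg hnn).1 hre
  refine Finset.sum_eq_zero fun m hm => ?_
  have hm0 := hz m hm
  rcases hA n m with h1 | h1
  · rw [hX n m h1, zero_mul]
  · rcases hB m l with h2 | h2
    · rw [hY m l h2, mul_zero]
    · simp [h1, h2] at hm0

/-- The product map `F : spr(A) × spr(B) → spr(AB)`, `(X, Y) ↦ XY`. -/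
def prodMap {N : ℕ} {A B : Matrix (Fin N) (Fin N) ℂ} (hA : IsZeroOne A) (hB : IsZeroOne B)
    (p : spr A × spr B) : spr (A * B) :=
  ⟨(p.1 : Matrix (Fin N) (Fin N) ℂ) * (p.2 : Matrix (Fin N) (Fin N) ℂ),
    mul_mem_spr hA hB p.1.2 p.2.2⟩

/-- The matrix of `spr(P)` with prescribed free entries, one for each element of `E(P)`. -/
noncomputable def ofEntries {N : ℕ} (P : Matrix (Fin N) (Fin N) ℂ) (x : edges P → ℂ) : spr P :=
  ⟨Matrix.of fun n l => if h : (n, l) ∈ edges P then x ⟨(n, l), h⟩ else 0, fun n l h => by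
    simp [edges, h]⟩

theorem continuous_ofEntries {N : ℕ} (P : Matrix (Fin N) (Fin N) ℂ) :
    Continuous (ofEntries P) := by
  refine Continuous.subtype_mk (continuous_matrix fun n l => ?_) _
  by_cases h : (n, l) ∈ edges P
  · simpa [h] using continuous_apply (⟨(n, l), h⟩ : edges P)
  · simpa [h] using continuous_const

/-- The Borel `σ`-algebra of `spr(P)`. -/
noncomputable instance sprMeasurableSpace {N : ℕ} (P : Matrix (Fin N) (Fin N) ℂ) : MeasurableSpace (spr P) :=
  borel (spr P)

instance sprBorelSpace {N : ℕ} (P : Matrix (Fin N) (Fin N) ℂ) : BorelSpace (spr P) :=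
  ⟨rfl⟩

theorem measurable_ofEntries {N : ℕ} (P : Matrix (Fin N) (Fin N) ℂ) :
    Measurable (ofEntries P) :=
  (continuous_ofEntries P).measurable

/-- Lebesgue measure on `spr(P)`: the image of Lebesgue measure on `ℂ ^ E(P)` under the
identification of a matrix in `spr(P)` with the vector of its free entries. -/
noncomputable def lebesgue {N : ℕ} (P : Matrix (Fin N) (Fin N) ℂ) : Measure (spr P) :=
  Measure.map (ofEntries P) volume

end SparseProd

/-!
The product map is polynomial in the free entries, and it is dominant: at the point `(A, 1)` its
derivative is `(dX, dY) ↦ dX + A * dY`. The summand `dX` reaches every entry in `E(A)`. For a new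
edge `e = (n, l)` choose `m` with `A n m * B m l ≠ 0`; as the extension is simple, the entry
`dY m l` contributes to no new edge but `e`, so that the new entries can be prescribed independently
of each other. Hence the derivative is onto (`exists_tangent`), and the image of the map contains a
non-empty open set.

A polynomial that vanishes on the image of a dominant map is zero, which says that the comorphism
between the polynomial rings is injective. By Chevalley's theorem the range of the induced map of
prime spectra is constructible; it contains the generic point, hence a basic open set, and the
Nullstellensatz turns the primes over a closed point into an honest preimage. So the image of the
map contains the complement of the zero set of one non-zero polynomial
(`MvPolynomial.exists_ne_zero_forall_exists_eval_eq`). Such a zero set is closed and Lebesgue-null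
(`MvPolynomial.volume_zeros_eq_zero`), and all the claims follow.
-/

/-! ### Zero sets of polynomials are null -/

namespace MvPolynomial

theorem volume_zeros_eq_zero_fin : ∀ {n : ℕ} {p : MvPolynomial (Fin n) ℂ}, p ≠ 0 →
    volume {x : Fin n → ℂ | eval x p = 0} = 0
  | 0, p, hp => by
    obtain ⟨c, rfl⟩ := C_surjective (R := ℂ) (Fin 0) p
    have hc : c ≠ 0 := fun h => hp (by rw [h, C_0])
    simp [hc]
  | n + 1, p, hp => by
    have hq : finSuccEquiv ℂ n p ≠ 0 := by simpa using hp
    obtain ⟨i, hi⟩ : ∃ i, (finSuccEquiv ℂ n p).coeff i ≠ 0 := by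
      by_contra! h
      exact hq (Polynomial.ext fun i => by simpa using h i)
    have ih := volume_zeros_eq_zero_fin hi
    have hmeas : MeasurableSet
        {z : (Fin n → ℂ) × ℂ | eval (Fin.cons z.2 z.1 : Fin (n + 1) → ℂ) p = 0} := by
      refine IsClosed.measurableSet (isClosed_eq ?_ continuous_const)
      exact (continuous_eval p).comp
        (Continuous.finCons (A := fun _ => ℂ) continuous_snd continuous_fst)
    have hprod : (volume : Measure ((Fin n → ℂ) × ℂ))
        {z | eval (Fin.cons z.2 z.1 : Fin (n + 1) → ℂ) p = 0} = 0 := by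
      rw [Measure.volume_eq_prod, Measure.measure_prod_null hmeas]
      have hae : ∀ᵐ s : Fin n → ℂ, eval s ((finSuccEquiv ℂ n p).coeff i) ≠ 0 := by
        simpa [ae_iff] using ih
      filter_upwards [hae] with s hs
      -- for such `s`, the slice is the root set of a non-zero polynomial in one variable
      have hne : Polynomial.map (eval s) (finSuccEquiv ℂ n p) ≠ 0 := fun h => hs <| by
        simpa using congrArg (fun r => Polynomial.coeff r i) h
      refine Set.Finite.measure_zero ?_ _
      refine (Polynomial.finite_setOfPred_isRoot hne).subset fun y hy => ?_
      have hy' : eval (Fin.cons y s : Fin (n + 1) → ℂ) p = 0 := hy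
      rwa [eval_eq_eval_mv_eval'] at hy'
    have hpres := (volume_preserving_piFinSuccAbove (fun _ : Fin (n + 1) => ℂ) 0)
    have hswap : MeasurePreserving (Prod.swap : ℂ × (Fin n → ℂ) → (Fin n → ℂ) × ℂ) :=
      Measure.measurePreserving_swap
    have := (hswap.comp hpres).measure_preimage hmeas.nullMeasurableSet
    rw [hprod] at this
    rw [← this]
    congr 1
    ext x
    simp [MeasurableEquiv.piFinSuccAbove, Fin.insertNthEquiv]

theorem volume_zeros_eq_zero {σ : Type*} [Fintype σ] {p : MvPolynomial σ ℂ} (hp : p ≠ 0) :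
    volume {x : σ → ℂ | eval x p = 0} = 0 := by
  let e := Fintype.equivFin σ
  have hq : rename e p ≠ 0 := by
    simpa using (rename_injective e e.injective).ne hp
  have hmeas : MeasurableSet {x : Fin (Fintype.card σ) → ℂ | eval x (rename e p) = 0} :=
    (isClosed_eq (continuous_eval _) continuous_const).measurableSet
  have hpres := volume_measurePreserving_piCongrLeft (fun _ : Fin (Fintype.card σ) => ℂ) e
  have := hpres.measure_preimage hmeas.nullMeasurableSet
  rw [volume_zeros_eq_zero_fin hq] at this
  rw [← this]
  congr 1
  ext x
  have hx : (MeasurableEquiv.piCongrLeft (fun _ : Fin (Fintype.card σ) => ℂ) e x) ∘ e = x := by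
    ext i
    exact Equiv.piCongrLeft_apply_apply (fun _ : Fin (Fintype.card σ) => ℂ) e x i
  simp [eval_rename, hx]

theorem dense_compl_zeros {σ : Type*} [Fintype σ] {p : MvPolynomial σ ℂ} (hp : p ≠ 0) :
    Dense {x : σ → ℂ | eval x p ≠ 0} :=
  Measure.dense_of_ae (μ := volume) (by simpa [ae_iff] using volume_zeros_eq_zero hp)

/-! ### Images of dominant polynomial maps -/

/-- A constructible subset of the spectrum of a domain that contains the generic point contains a
non-empty basic open set. -/
theorem _root_.PrimeSpectrum.exists_basicOpen_subset_of_isConstructible {R : Type*} [CommRing R]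
    [IsDomain R] {s : Set (PrimeSpectrum R)} (hs : Topology.IsConstructible s)
    (hbot : (⊥ : PrimeSpectrum R) ∈ s) :
    ∃ h : R, h ≠ 0 ∧ (PrimeSpectrum.basicOpen h : Set (PrimeSpectrum R)) ⊆ s := by
  obtain ⟨S, rfl⟩ := PrimeSpectrum.exists_constructibleSetData_iff.2 hs
  simp only [PrimeSpectrum.ConstructibleSetData.toSet, Set.mem_iUnion] at hbot
  obtain ⟨D, hD, hg, hf⟩ := hbot
  refine ⟨D.f, fun h => hf (by simp [h]), fun q hq => ?_⟩
  refine Set.mem_biUnion hD ⟨?_, fun hqf => hq (hqf rfl)⟩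
  rintro _ ⟨i, rfl⟩
  have hi : D.g i = 0 := by simpa using hg ⟨i, rfl⟩
  rw [hi]
  exact q.asIdeal.zero_mem

/-- If the polynomials `F i` are algebraically independent, then the image of the map that they
define contains the complement of a hypersurface. -/
theorem exists_ne_zero_forall_exists_eval_eq {K : Type*} [Field K] [IsAlgClosed K] {σ τ : Type*}
    [Finite σ] [Finite τ] (F : τ → MvPolynomial σ K) (hF : AlgebraicIndependent K F) :
    ∃ h : MvPolynomial τ K, h ≠ 0 ∧
      ∀ y : τ → K, eval y h ≠ 0 → ∃ x : σ → K, ∀ i, eval x (F i) = y i := by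
  let φ : MvPolynomial τ K →+* MvPolynomial σ K := (aeval F).toRingHom
  have hφ : Function.Injective φ := hF
  have hfin : φ.FinitePresentation := by
    refine RingHom.FinitePresentation.of_finiteType.1
      (RingHom.FiniteType.of_comp_finiteType (f := C) ?_)
    have : φ.comp C = algebraMap K (MvPolynomial σ K) := by
      ext a
      simp [φ]
    rw [this]
    exact RingHom.finiteType_algebraMap.2 inferInstance
  have hbot : (⊥ : PrimeSpectrum (MvPolynomial τ K)) ∈ Set.range (PrimeSpectrum.comap φ) := by
    refine ⟨⊥, PrimeSpectrum.ext ?_⟩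
    change Ideal.comap φ ⊥ = ⊥
    rw [← RingHom.ker_eq_comap_bot, (RingHom.injective_iff_ker_eq_bot φ).1 hφ]
  obtain ⟨h, hne, hsub⟩ := PrimeSpectrum.exists_basicOpen_subset_of_isConstructible
    (PrimeSpectrum.isConstructible_range_comap hfin) hbot
  refine ⟨h, hne, fun y hy => ?_⟩
  obtain ⟨q, hq⟩ := hsub (show (⟨RingHom.ker (eval y), RingHom.ker_isPrime _⟩ :
    PrimeSpectrum (MvPolynomial τ K)) ∈ PrimeSpectrum.basicOpen h from hy)
  obtain ⟨M, hM, hqM⟩ := q.asIdeal.exists_le_maximal q.isPrime.ne_top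
  obtain ⟨x, rfl⟩ := eq_vanishingIdeal_singleton_of_isMaximal K hM
  refine ⟨x, fun i => ?_⟩
  have hmem : X i - C (y i) ∈ Ideal.comap φ q.asIdeal := by
    rw [← PrimeSpectrum.comap_asIdeal, hq]
    simp [RingHom.mem_ker]
  have := hqM hmem
  simpa [φ, sub_eq_zero, coe_aeval_eq_eval] using this

/-- Polynomials whose joint derivative is onto at some point are algebraically independent: their
values fill a neighbourhood of a point, and no non-zero polynomial vanishes there. -/
theorem algebraicIndependent_of_hasStrictFDerivAt {σ τ : Type*} [Fintype σ] [Fintype τ]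
    (F : τ → MvPolynomial σ ℂ) {x : σ → ℂ} {f' : (σ → ℂ) →L[ℂ] (τ → ℂ)}
    (hf : HasStrictFDerivAt (fun u i => eval u (F i)) f' x) (hsurj : Function.Surjective f') :
    AlgebraicIndependent ℂ F := by
  rw [algebraicIndependent_iff]
  intro p hp
  by_contra hne
  have hnhds := hf.map_nhds_eq_of_surj (LinearMap.range_eq_top.2 hsurj)
  have hzero : ∀ᶠ y in nhds (fun i => eval x (F i)), eval y p = 0 := by
    rw [← hnhds, Filter.eventually_map]
    refine Filter.Eventually.of_forall fun u => ?_
    have := congrArg (eval u) hp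
    rw [map_zero, aeval_def, eval₂_eq', map_sum] at this
    rw [eval_eq']
    simpa using this
  obtain ⟨y, hy, hy0⟩ := mem_closure_iff_nhds.1 (dense_compl_zeros hne _) _ hzero
  exact hy0 hy

end MvPolynomial

/-! ### The derivative of the product map -/

namespace SparseProd

open MvPolynomial

variable {N : ℕ}

/-- The `(n, l)` entry of the product of a matrix in `spr A` and one in `spr B`, as a polynomial. The variables `inl (n, m)` and `inr (m, l)` stand for all entries of the two factors; multiplication
by the zero-one coefficients `A n m` and `B m l` discards those that are not free. -/
noncomputable def prodPoly (A B : Matrix (Fin N) (Fin N) ℂ) (e : Fin N × Fin N) :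
    MvPolynomial ((Fin N × Fin N) ⊕ (Fin N × Fin N)) ℂ :=
  ∑ m, C (A e.1 m * B m e.2) * (X (Sum.inl (e.1, m)) * X (Sum.inr (m, e.2)))

theorem eval_prodPoly (A B : Matrix (Fin N) (Fin N) ℂ) (e : Fin N × Fin N)
    (u : (Fin N × Fin N) ⊕ (Fin N × Fin N) → ℂ) :
    eval u (prodPoly A B e) =
      ∑ m, (A e.1 m * B m e.2) * (u (Sum.inl (e.1, m)) * u (Sum.inr (m, e.2))) := by
  simp [prodPoly]

/-- The derivative of the product map is onto at `(A, 1)`: every pattern `v` on `E(AB)` is of the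
form `dX + A * dY` with `dX`, `dY` in `spr A`, `spr B`. -/
theorem exists_tangent {A B : Matrix (Fin N) (Fin N) ℂ} (hA : IsZeroOne A)
    (hs : IsSimpleExtension A B) (v : Fin N × Fin N → ℂ) :
    ∃ dX ∈ spr A, ∃ dY ∈ spr B, ∀ e ∈ edges (A * B), (dX + A * dY) e.1 e.2 = v e := by
  have hc : ∀ e : Fin N × Fin N, ∃ m, e ∈ edges (A * B) → A e.1 m * B m e.2 ≠ 0 := by
    intro e
    by_cases he : e ∈ edges (A * B)
    · have h : (A * B) e.1 e.2 ≠ 0 := by simpa [edges] using he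
      rw [Matrix.mul_apply] at h
      obtain ⟨m, -, hm⟩ := Finset.exists_ne_zero_of_sum_ne_zero h
      exact ⟨m, fun _ => hm⟩
    · exact ⟨e.1, fun h => absurd h he⟩
  choose c hc using hc
  -- the value of a new edge `p` is placed at the one entry `(c p, p.2)` of `dY`
  let dY : Matrix (Fin N) (Fin N) ℂ :=
    Matrix.of fun m l => ∑ p ∈ newEdges A B m l, if c p = m then v p else 0
  -- `dX` corrects the entries in `E(A)` that `A * dY` disturbs
  let dX : Matrix (Fin N) (Fin N) ℂ :=
    Matrix.of fun n l => if A n l = 0 then 0 else v (n, l) - (A * dY) n l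
  refine ⟨dX, fun n l h => by simp [dX, h], dY, fun m l h => by simp [dY, newEdges, h], ?_⟩
  rintro ⟨n, l⟩ he
  by_cases hnl : A n l = 0
  · have hnew : ∀ m, A n m * B m l ≠ 0 → newEdges A B m l = {(n, l)} := by
      intro m hm
      have hmem : (n, l) ∈ newEdges A B m l := by
        exact Finset.mem_filter.2 ⟨Finset.mem_sdiff.2 ⟨he, by simp [edges, hnl]⟩, rfl, hm⟩
      have hB : (m, l) ∈ edges B := by simpa [edges] using right_ne_zero_of_mul hm
      exact Finset.eq_singleton_iff_unique_mem.2
        ⟨hmem, fun p hp => Finset.card_le_one.1 (hs m l hB) _ hp _ hmem⟩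
    have hterm : ∀ m, A n m * dY m l = if c (n, l) = m then v (n, l) else 0 := by
      intro m
      by_cases hm : A n m * B m l = 0
      · have hcm : c (n, l) ≠ m := fun h => hc (n, l) he (h ▸ hm)
        rcases mul_eq_zero.1 hm with h | h
        · simp [h, hcm]
        · simp [dY, newEdges, h, hcm]
      · have h1 : A n m = 1 := (hA n m).resolve_left (left_ne_zero_of_mul hm)
        simp [dY, hnew m hm, h1]
    simp [dX, hnl, Matrix.mul_apply, hterm]
  · simp [dX, hnl]

/-- The entries of the product map are algebraically independent, that is, the map is dominant. -/
theorem algebraicIndependent_prodPoly {A B : Matrix (Fin N) (Fin N) ℂ} (hAB : IsCompatible A B)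
    (hs : IsSimpleExtension A B) :
    AlgebraicIndependent ℂ fun e : edges (A * B) => prodPoly A B e := by
  -- masking by `A` and `B` turns this point into the pair `(A, 1)`, as `B` has ones on the diagonal
  let u₀ : (Fin N × Fin N) ⊕ (Fin N × Fin N) → ℂ :=
    Sum.elim (fun _ => 1) fun p => if p.1 = p.2 then 1 else 0
  let π (i : (Fin N × Fin N) ⊕ (Fin N × Fin N)) :
      ((Fin N × Fin N) ⊕ (Fin N × Fin N) → ℂ) →L[ℂ] ℂ := ContinuousLinearMap.proj i
  have hπ : ∀ i, HasStrictFDerivAt (fun u => u i) (π i) u₀ := fun i => (π i).hasStrictFDerivAt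
  have hder := hasStrictFDerivAt_pi.2 fun e : edges (A * B) =>
    HasStrictFDerivAt.fun_sum (u := Finset.univ) fun m _ =>
      ((hπ (Sum.inl (e.1.1, m))).mul (hπ (Sum.inr (m, e.1.2)))).const_mul (A e.1.1 m * B m e.1.2)
  have hfun : (fun u (e : edges (A * B)) => eval u (prodPoly A B e)) = fun u e =>
      ∑ m, (A e.1.1 m * B m e.1.2) * (u (Sum.inl (e.1.1, m)) * u (Sum.inr (m, e.1.2))) := by
    funext u e
    exact eval_prodPoly A B e u
  refine algebraicIndependent_of_hasStrictFDerivAt _ (hfun ▸ hder) fun v => ?_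
  obtain ⟨dX, hdX, dY, hdY, h⟩ := exists_tangent hAB.zeroOne_left hs
    fun p => if hp : p ∈ edges (A * B) then v ⟨p, hp⟩ else 0
  refine ⟨Sum.elim (fun p => dX p.1 p.2) fun p => dY p.1 p.2, funext fun e => ?_⟩
  have hX : ∀ n l, A n l * dX n l = dX n l := fun n l => by
    rcases hAB.zeroOne_left n l with h0 | h0
    · rw [hdX n l h0, mul_zero]
    · rw [h0, one_mul]
  have hY : ∀ n l, B n l * dY n l = dY n l := fun n l => by
    rcases hAB.zeroOne_right n l with h0 | h0
    · rw [hdY n l h0, mul_zero]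
    · rw [h0, one_mul]
  have hB : ∀ n, B n n = 1 := fun n => (hAB.zeroOne_right n n).resolve_left (hAB.diag_right n)
  have he := h e.1 e.2
  rw [dif_pos e.2, Matrix.add_apply, Matrix.mul_apply] at he
  rw [show v e = v ⟨e.1, e.2⟩ from rfl, ← he]
  simp only [ContinuousLinearMap.coe_pi', sum_apply,
    smul_apply, add_apply, π,
    ContinuousLinearMap.proj_apply, u₀, Sum.elim_inl, Sum.elim_inr, smul_eq_mul, one_mul, mul_add,
    Finset.sum_add_distrib, ite_mul, zero_mul, mul_ite, mul_zero, Finset.sum_ite_eq',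
    Finset.mem_univ, if_true]
  rw [hB, mul_one, hX, add_comm]
  refine congrArg₂ _ rfl (Finset.sum_congr rfl fun m _ => ?_)
  rw [mul_assoc, hY]

/-! ### Transfer to the sparsity class -/

/-- The vector of the free entries of a matrix in `spr P`. -/
def toEntries (P : Matrix (Fin N) (Fin N) ℂ) (M : spr P) : edges P → ℂ :=
  fun e => (M : Matrix (Fin N) (Fin N) ℂ) e.1.1 e.1.2

theorem continuous_toEntries (P : Matrix (Fin N) (Fin N) ℂ) : Continuous (toEntries P) :=
  continuous_pi fun _ => continuous_subtype_val.matrix_elem _ _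

theorem toEntries_ofEntries (P : Matrix (Fin N) (Fin N) ℂ) (x : edges P → ℂ) :
    toEntries P (ofEntries P x) = x := by
  funext e
  simp [toEntries, ofEntries]

theorem ofEntries_toEntries (P : Matrix (Fin N) (Fin N) ℂ) (M : spr P) :
    ofEntries P (toEntries P M) = M := by
  ext n l
  by_cases h : (n, l) ∈ edges P
  · simp [toEntries, ofEntries, h]
  · have h0 : P n l = 0 := by simpa [edges] using h
    simp [ofEntries, h, M.2 n l h0]

/-- Outside the zero set of a suitable non-zero polynomial in the free entries, every matrix in
`spr (A * B)` is a product. -/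
theorem exists_polynomial_forall_mem_range {A B : Matrix (Fin N) (Fin N) ℂ}
    (hAB : IsCompatible A B) (hs : IsSimpleExtension A B) :
    ∃ h : MvPolynomial (edges (A * B)) ℂ, h ≠ 0 ∧ ∀ M : spr (A * B),
      eval (toEntries _ M) h ≠ 0 →
        M ∈ Set.range (prodMap hAB.zeroOne_left hAB.zeroOne_right) := by
  obtain ⟨h, hne, H⟩ :=
    exists_ne_zero_forall_exists_eval_eq _ (algebraicIndependent_prodPoly hAB hs)
  refine ⟨h, hne, fun M hM => ?_⟩
  obtain ⟨u, hu⟩ := H _ hM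
  let X : spr A := ⟨Matrix.of fun n m => A n m * u (Sum.inl (n, m)), fun n m h0 => by simp [h0]⟩
  let Y : spr B := ⟨Matrix.of fun m l => B m l * u (Sum.inr (m, l)), fun m l h0 => by simp [h0]⟩
  refine ⟨(X, Y), ?_⟩
  rw [← ofEntries_toEntries _ M, ← ofEntries_toEntries _ (prodMap _ _ (X, Y))]
  congr 1
  funext e
  rw [← hu e, eval_prodPoly]
  simp only [toEntries, prodMap, Matrix.mul_apply, X, Y, Matrix.of_apply]
  exact Finset.sum_congr rfl fun m _ => mul_mul_mul_comm _ _ _ _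

end SparseProd

theorem mainTheorem1 (N : ℕ) (A B : Matrix (Fin N) (Fin N) ℂ)
    (hAB : SparseProd.IsCompatible A B) (hs : SparseProd.IsSimpleExtension A B) :
    (∃ U : Set (SparseProd.spr (A * B)), IsOpen U ∧ Dense U ∧
      U ⊆ Set.range (SparseProd.prodMap hAB.zeroOne_left hAB.zeroOne_right)) ∧
    SparseProd.lebesgue (A * B)
      (closure (Set.range (SparseProd.prodMap hAB.zeroOne_left hAB.zeroOne_right))ᶜ) = 0 ∧
    (∀ᵐ C : SparseProd.spr (A * B) ∂(SparseProd.lebesgue (A * B)),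
      ∃ X ∈ SparseProd.spr A, ∃ Y ∈ SparseProd.spr B,
        X * Y = (C : Matrix (Fin N) (Fin N) ℂ)) ∧
    IsNowhereDense (closure {C : SparseProd.spr (A * B) |
      ¬ ∃ X ∈ SparseProd.spr A, ∃ Y ∈ SparseProd.spr B,
        X * Y = (C : Matrix (Fin N) (Fin N) ℂ)}) := by
  obtain ⟨h, hne, H⟩ := SparseProd.exists_polynomial_forall_mem_range hAB hs
  have hcont : Continuous fun M : SparseProd.spr (A * B) =>
      MvPolynomial.eval (SparseProd.toEntries _ M) h :=
    (MvPolynomial.continuous_eval h).comp (SparseProd.continuous_toEntries _)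
  have hopen : IsOpen {M : SparseProd.spr (A * B) |
      MvPolynomial.eval (SparseProd.toEntries _ M) h ≠ 0} :=
    isOpen_ne_fun hcont continuous_const
  have hclosed : IsClosed {M : SparseProd.spr (A * B) |
      MvPolynomial.eval (SparseProd.toEntries _ M) h = 0} :=
    isClosed_eq hcont continuous_const
  have hdense : Dense {M : SparseProd.spr (A * B) |
      MvPolynomial.eval (SparseProd.toEntries _ M) h ≠ 0} := by
    have hsurj : Function.Surjective (SparseProd.ofEntries (A * B)) := fun M =>
      ⟨_, SparseProd.ofEntries_toEntries _ M⟩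
    refine (hsurj.denseRange.dense_image (SparseProd.continuous_ofEntries _)
      (MvPolynomial.dense_compl_zeros hne)).mono ?_
    rintro _ ⟨x, hx, rfl⟩
    simpa [SparseProd.toEntries_ofEntries] using hx
  have hnull : SparseProd.lebesgue (A * B) {M : SparseProd.spr (A * B) |
      MvPolynomial.eval (SparseProd.toEntries _ M) h = 0} = 0 := by
    rw [SparseProd.lebesgue, Measure.map_apply (SparseProd.measurable_ofEntries _)
      hclosed.measurableSet]
    simpa [SparseProd.toEntries_ofEntries] using MvPolynomial.volume_zeros_eq_zero hne
  have hcompl : (Set.range (SparseProd.prodMap hAB.zeroOne_left hAB.zeroOne_right))ᶜ ⊆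
      {M | MvPolynomial.eval (SparseProd.toEntries _ M) h = 0} := fun M hM =>
    of_not_not fun hM0 => hM (H M hM0)
  have hset : {M : SparseProd.spr (A * B) | ¬ ∃ X ∈ SparseProd.spr A, ∃ Y ∈ SparseProd.spr B,
      X * Y = (M : Matrix (Fin N) (Fin N) ℂ)} =
      (Set.range (SparseProd.prodMap hAB.zeroOne_left hAB.zeroOne_right))ᶜ := by
    ext M
    simp only [Set.mem_ofPred_eq, Set.mem_compl_iff, not_iff_not]
    constructor
    · rintro ⟨X, hX, Y, hY, hXY⟩
      exact ⟨(⟨X, hX⟩, ⟨Y, hY⟩), Subtype.ext hXY⟩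
    · rintro ⟨⟨X, Y⟩, rfl⟩
      exact ⟨X, X.2, Y, Y.2, rfl⟩
  refine ⟨⟨_, hopen, hdense, H⟩, measure_mono_null (closure_minimal hcompl hclosed) hnull, ?_, ?_⟩
  · rw [ae_iff, hset]
    exact measure_mono_null hcompl hnull
  · rw [hset, IsNowhereDense, closure_closure, interior_eq_empty_iff_dense_compl]
    exact hdense.mono (Set.compl_subset_compl.2 (closure_minimal hcompl hclosed))
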